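/- Let $N=[n]$ be a set of agents and $G$ a finite set of goods. **Valuations.** A function $v:2^G\to\mathbb{R}_{\ge 0}$ is a *matroid rank function* (MRF) if, with $\Delta(S,g)=v(S\cup\{g\})-v(S)$, we have $v(\emptyset)=0$, $\Delta(S,g)\in\{0,1\}$ for all $S\subseteq G$ and $g\in G$, and $\Delta(S,g)\ge\Delta(T,g)$ for all $S\subseteq T\subseteq G$ and $g\in G$. **Allocations.** An allocation is a partition $X=(X_0,X_1,\dots,X_n)$ of $G$, where $X_i$ is the bundle of agent $i\in N$ and $X_0$ is the set of unallocated goods. Put $v_0(S)=|S|$. Let $\vec u^X=(v_1(X_1),\dots,v_n(X_n))$ and $F_i(X)=\{g: v_i(X_i\cup\{g\})-v_i(X_i)=1\}$. The exchange graph $\mathcal G(X)$ is the directed graph on $G$ with an edge from $g\in X_k$ to $g'$ ($k\in\{0\}\cup N$) whenever $v_k((X_k\setminus\{g\})\cup\{g'\})=v_k(X_k)$. **Valid gain functions.** A justice criterion $\Psi$ is a total preorder $\succeq_\Psi$ on $\mathbb{Z}^n_{\ge 0}$; write $=_\Psi$ for ties. Let $\phi$ map each pair $(\vec x,i)\in\mathbb{Z}^n_{\ge0}\times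 N$ to a vector in $\mathbb{R}^b$, these vectors being compared lexicographically. Let $\vec e_i$ be the $i$-th unit vector. We call $\phi$ *valid* if there is a justice criterion $\Psi$ such that * (C1) if $x_h\ge y_h$ for all $h\in N$, then $\vec x\succeq_\Psi\vec y$, and $\vec x=_\Psi\vec y$ iff $\vec x=\vec y$; * (G1) if $\phi(\vec x,i)\ge\phi(\vec x,j)$, then $\vec x+\vec e_i\succeq_\Psi\vec x+\vec e_j$, and $\vec x+\vec e_i=_\Psi\vec x+\vec e_j$ iff $\phi(\vec x,i)=\phi(\vec x,j)$; * (G2) if $x_i\le y_i$, then $\phi(\vec x,i)\ge\phi(\vec y,i)$, with equality if $x_i=y_i$. **General Yankee Swap** with input $\phi$ and MRF valuations $v_1,\dots,v_n$ starts with $X_0=G$, all other bundles empty, and $U=N$. While $U\ne\emptyset$, let $i$ be the agent of least index among the maximizers of $\phi(\vec u^X,\cdot)$ over $U$. If $\mathcal G(X)$ contains a path from $F_i(X)$ to $X_0$, take any shortest such path $(g_1,\dots,g_t)$, and simultaneously give $g_1$ to $i$ and each $g_{j+1}$ to the owner of $g_j$ under $X$ ($1\le j<t$). Otherwise remove $i$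 from $U$. When $U=\emptyset$, output $X$. **The Yankee Swap mechanism** with gain function $\phi$ asks each agent for a function $2^G\to\mathbb{R}_{\ge0}$, replaces every report that is not an MRF by the zero valuation, and runs General Yankee Swap with input $\phi$ on the resulting profile. **Theorem.** Let $\phi$ be a valid gain function. Then the Yankee Swap mechanism with gain function $\phi$ has at least one outcome on every profile of reports, and it is strategyproof when agents have matroid rank valuations: let $i\in N$ have a true valuation $v_i$ that is an MRF, and fix arbitrary reports of the other agents and an arbitrary report $v_i'$ of $i$. If $X$ is an outcome of the mechanism when $i$ reports $v_i$, and $X'$ is an outcome when $i$ reports $v_i'$ (for any choices of shortest paths in the two runs), then $v_i(X_i)\ge v_i(X'_i)$. -/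

import Mathlib

open scoped NNReal

noncomputable section

namespace YankeeSwap

/-! ### Valuations -/

/-- A valuation function `v : 2^G → ℝ≥0` on a set of goods `G`. -/
abbrev Valuation (G : Type*) := Finset G → ℝ≥0

/-- The marginal gain `Δ(S, g) = v(S + g) - v(S)`, a real number. -/
def marginal {G : Type*} [DecidableEq G] (v : Valuation G) (S : Finset G) (g : G) : ℝ :=
  (v (insert g S) : ℝ) - (v S : ℝ)

/-- Matroid rank functions (binary submodular valuations). -/
structure IsMRF {G : Type*} [DecidableEq G] (v : Valuation G) : Prop where
  empty : v ∅ = 0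
  binary : ∀ (S : Finset G) (g : G), marginal v S g = 0 ∨ marginal v S g = 1
  submodular : ∀ (S T : Finset G) (g : G), S ⊆ T → marginal v T g ≤ marginal v S g

/-! ### Allocations

An allocation is a partition `(X_0, X_1, …, X_n)` of the goods, recorded by the map that sends
each good to its owner. The owner `none` is the pool of unallocated goods ("agent 0"). -/

/-- Allocations of the goods `G` among `n` agents: `X g = some i` means `g ∈ X_i`, and
`X g = none` means that `g` is unallocated. -/
abbrev Allocation (n : ℕ) (G : Type*) := G → Option (Fin n)

/-- The bundle `X_k`, for `k` an agent or the pool `none`. -/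
def bundle {n : ℕ} {G : Type*} [Fintype G] (X : Allocation n G) (k : Option (Fin n)) :
    Finset G :=
  Finset.univ.filter fun g => X g = k

/-- The valuation profile extended to "agent 0", whose valuation is `v_0(S) = |S|`. -/
def extend {n : ℕ} {G : Type*} (v : Fin n → Valuation G) : Option (Fin n) → Valuation G
  | none => fun S => (S.card : ℝ≥0)
  | some i => v i

/-- The utility vector `(v_1(X_1), …, v_n(X_n))` as a vector of natural numbers. Matroid rank
functions take natural number values, so the floor changes nothing for them
(see `IsMRF.natFloor_eq`). -/
def utilityVector {n : ℕ} {G : Type*} [Fintype G] (v : Fin n → Valuation G)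
    (X : Allocation n G) : Fin n → ℕ :=
  fun i => ⌊v i (bundle X (some i))⌋₊

theorem IsMRF.natFloor_eq {G : Type*} [DecidableEq G] {v : Valuation G} (hv : IsMRF v)
    (S : Finset G) : ((⌊v S⌋₊ : ℕ) : ℝ≥0) = v S := by
  have key : ∃ k : ℕ, v S = k := by
    induction S using Finset.induction_on with
    | empty => exact ⟨0, by simpa using hv.empty⟩
    | insert g S _ ih =>
      obtain ⟨k, hk⟩ := ih
      rcases hv.binary S g with h | h
      · refine ⟨k, ?_⟩
        have h1 : (v (insert g S) : ℝ) = (v S : ℝ) := sub_eq_zero.mp h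
        rw [← hk]
        exact_mod_cast h1
      · refine ⟨k + 1, ?_⟩
        have h1 : (v (insert g S) : ℝ) = 1 + (v S : ℝ) := sub_eq_iff_eq_add.mp h
        apply NNReal.coe_injective
        rw [h1, hk]
        push_cast
        ring
  obtain ⟨k, hk⟩ := key
  rw [hk, Nat.floor_natCast]

/-! ### The exchange graph and transfers of goods along paths -/

/-- The exchange graph of `X`: there is an edge from `g ∈ X_k` to `g'` (where `k` is an agent or
the pool) when `v_k(X_k - g + g') = v_k(X_k)`. -/
def ExchangeEdge {n : ℕ} {G : Type*} [Fintype G] [DecidableEq G] (v : Fin n → Valuation G)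
    (X : Allocation n G) (g g' : G) : Prop :=
  extend v (X g) (insert g' ((bundle X (X g)).erase g)) = extend v (X g) (bundle X (X g))

/-- `F_i(X) = {g : Δ_i(X_i, g) = 1}`. -/
def desired {n : ℕ} {G : Type*} [Fintype G] [DecidableEq G] (v : Fin n → Valuation G)
    (X : Allocation n G) (i : Fin n) : Set G :=
  {g | marginal (v i) (bundle X (some i)) g = 1}

/-- `P = (g_1, …, g_t)`, `t ≥ 1`, is a path in the exchange graph of `X` from `F_i(X)` to the set
`X_0` of unallocated goods. -/
def IsTransferPath {n : ℕ} {G : Type*} [Fintype G] [DecidableEq G] (v : Fin n → Valuation G)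
    (X : Allocation n G) (i : Fin n) (P : List G) : Prop :=
  ∃ hP : P ≠ [], P.head hP ∈ desired v X i ∧ P.IsChain (ExchangeEdge v X) ∧
    X (P.getLast hP) = none

/-- A shortest path from `F_i(X)` to `X_0`. -/
def IsShortestTransferPath {n : ℕ} {G : Type*} [Fintype G] [DecidableEq G]
    (v : Fin n → Valuation G) (X : Allocation n G) (i : Fin n) (P : List G) : Prop :=
  IsTransferPath v X i P ∧ ∀ Q : List G, IsTransferPath v X i Q → P.length ≤ Q.length

/-- Path augmentation: along `P = (g_1, …, g_t)`, the good `g_1` is given to `k`, and each `g_{j+1}`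
is given to the owner that `g_j` has under `X`. All other goods stay where they are. -/
def augment {n : ℕ} {G : Type*} [DecidableEq G] (X : Allocation n G) :
    Option (Fin n) → List G → Allocation n G
  | _, [] => X
  | k, g :: P => Function.update (augment X (X g) P) g k

/-! ### Justice criteria and gain functions -/

/-- A justice criterion `Ψ`: a total comparison `x ⪰ y` of utility vectors in `ℤ_{≥0}^n`
(distinct vectors may be tied). -/
structure JusticeCriterion (n : ℕ) where
  /-- `x ⪰ y` -/
  ge : (Fin n → ℕ) → (Fin n → ℕ) → Prop
  total : ∀ x y, ge x y ∨ ge y x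
  trans : ∀ x y z, ge x y → ge y z → ge x z

/-- Equality with respect to `Ψ`: `x ⪰ y` and `y ⪰ x`. -/
def JusticeCriterion.Tie {n : ℕ} (Ψ : JusticeCriterion n) (x y : Fin n → ℕ) : Prop :=
  Ψ.ge x y ∧ Ψ.ge y x

/-- A gain function sends a utility vector and an agent to a vector of `ℝ^b`; these values are
compared lexicographically. -/
abbrev GainFunction (n b : ℕ) := (Fin n → ℕ) → Fin n → Lex (Fin b → ℝ)

/-- Pareto dominance. -/
def JusticeCriterion.ParetoDominance {n : ℕ} (Ψ : JusticeCriterion n) : Prop :=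
  ∀ x y : Fin n → ℕ, (∀ h, y h ≤ x h) → Ψ.ge x y ∧ (Ψ.Tie x y ↔ x = y)

/-- `x` with `1` added to its `i`-th coordinate. -/
def addOne {n : ℕ} (x : Fin n → ℕ) (i : Fin n) : Fin n → ℕ :=
  Function.update x i (x i + 1)

/-- `φ` is a gain function for `Ψ`. -/
structure IsGainFunctionFor {n b : ℕ} (Ψ : JusticeCriterion n) (φ : GainFunction n b) :
    Prop where
  coherent : ∀ (x : Fin n → ℕ) (i j : Fin n), φ x j ≤ φ x i →
    Ψ.ge (addOne x i) (addOne x j) ∧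
      (Ψ.Tie (addOne x i) (addOne x j) ↔ φ x i = φ x j)
  antitone : ∀ (x y : Fin n → ℕ) (i : Fin n), x i ≤ y i →
    φ y i ≤ φ x i ∧ (x i = y i → φ x i = φ y i)

/-- A gain function is valid if it is a gain function for some justice criterion that respects
Pareto dominance. -/
def IsValidGainFunction {n b : ℕ} (φ : GainFunction n b) : Prop :=
  ∃ Ψ : JusticeCriterion n, Ψ.ParetoDominance ∧ IsGainFunctionFor Ψ φ

/-! ### General Yankee Swap -/

/-- `i` is the agent that is picked among the agents `U` still in play: the least index among the
maximizers of `φ` over `U`. -/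
def IsPicked {n b : ℕ} (φ : GainFunction n b) (u : Fin n → ℕ) (U : Finset (Fin n))
    (i : Fin n) : Prop :=
  i ∈ U ∧ (∀ j ∈ U, φ u j ≤ φ u i) ∧ ∀ j ∈ U, φ u j = φ u i → i ≤ j

/-- One iteration of the loop of General Yankee Swap, on pairs of an allocation and a set of agents
still in play. Any shortest path may be used. -/
inductive Step {n b : ℕ} {G : Type*} [Fintype G] [DecidableEq G] (φ : GainFunction n b)
    (v : Fin n → Valuation G) :
    Allocation n G × Finset (Fin n) → Allocation n G × Finset (Fin n) → Prop
  | transfer (X : Allocation n G) (U : Finset (Fin n)) (i : Fin n) (P : List G) :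
      IsPicked φ (utilityVector v X) U i → IsShortestTransferPath v X i P →
      Step φ v (X, U) (augment X (some i) P, U)
  | remove (X : Allocation n G) (U : Finset (Fin n)) (i : Fin n) :
      IsPicked φ (utilityVector v X) U i → (¬ ∃ P : List G, IsTransferPath v X i P) →
      Step φ v (X, U) (X, U.erase i)

/-- `X` is an output of General Yankee Swap with gain function `φ` on the valuation profile `v`:
some run that starts with all goods unallocated and all agents in play ends with the allocation `X`
and no agent in play. -/
def IsOutput {n b : ℕ} {G : Type*} [Fintype G] [DecidableEq G] (φ : GainFunction n b)
    (v : Fin n → Valuation G) (X : Allocation n G) : Prop :=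
  Relation.ReflTransGen (Step φ v) ((fun _ => none), Finset.univ) (X, ∅)

/-! ### The mechanism and strategyproofness -/

open Classical in
/-- Every report that is not a matroid rank function is replaced by the zero valuation. -/
def screen {n : ℕ} {G : Type*} [DecidableEq G] (r : Fin n → Valuation G) : Fin n → Valuation G :=
  fun i => if IsMRF (r i) then r i else 0

/-- The Yankee Swap mechanism: the set of the possible outcomes on a profile `r` of arbitrary
reported valuations. -/
def mechanism {n b : ℕ} {G : Type*} [Fintype G] [DecidableEq G] (φ : GainFunction n b)
    (r : Fin n → Valuation G) : Set (Allocation n G) :=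
  {X | IsOutput φ (screen r) X}

/-- Strategyproofness when the true valuations come from `D`: an agent `i` with true valuation
`v ∈ D` never gets a better outcome under a profile `r` of reports than when reporting `v`
instead of `r i`. The other agents' reports are arbitrary, and the inequality holds for all possible
outcomes on the two profiles. -/
def StrategyproofOn {n : ℕ} {G : Type*} [Fintype G] (D : Set (Valuation G))
    (M : (Fin n → Valuation G) → Set (Allocation n G)) : Prop :=
  ∀ (r : Fin n → Valuation G) (i : Fin n) (v : Valuation G), v ∈ D →
    ∀ X ∈ M (Function.update r i v), ∀ X' ∈ M r,
      v (bundle X' (some i)) ≤ v (bundle X (some i))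

end YankeeSwap

end

namespace YankeeSwap

/-! ### Rank functions with natural number values -/

/-! Call an allocation non-redundant if every agent's bundle is independent in its matroid. The size
vectors of such allocations are downward closed and have the polymatroid exchange property
`Feasible.exchange`. This rests on two facts: augmenting along a shortest path gives its agent one
more unit and leaves the other utilities alone (`NonRedundant.augment`), and a reachability argument
in the exchange graph produces a path for some deficient agent (`exists_isTransferPath`).

A run is thus a greedy procedure on the polymatroid. By (G2) an agent's gain depends antitonically
on its own utility alone, so requests "unit `k` for agent `i`" are served by a priority `Before`
that is the same for all profiles.

For strategyproofness, suppose that `i` ends the truthful run with `k` goods while a misreport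
yields true value above `k`. Let `y` be the utility vector when the truthful run removes `i`, and
`y'` the one when the other run grants `i` its unit number `k` (counted from zero). Trimming the
misreporter's bundle to a truly independent set makes `addOne y' i` feasible for the truthful
profile. A first exchange shows that the other agents hold in total at least as much in `y'` as in
`y`; a second one raises `y` at some coordinate. In both, a coordinate other than `i` would have to
come both before and after the request of `i`. Hence `addOne y i` is feasible, although `i` was
removed at `y` (`Checkpoint.feasible_addOne`). -/

/-- Integer-valued matroid rank functions. -/
structure IsRank {G : Type*} [DecidableEq G] (r : Finset G → ℕ) : Prop where
  empty : r ∅ = 0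
  le_insert : ∀ S g, r S ≤ r (insert g S)
  insert_le : ∀ S g, r (insert g S) ≤ r S + 1
  insert_eq : ∀ S T g, S ⊆ T → r (insert g S) = r S → r (insert g T) = r T

/-- The natural number valued version of a valuation. -/
noncomputable def rank {G : Type*} (v : Valuation G) (S : Finset G) : ℕ := ⌊v S⌋₊

/-- `x` lies in the span of `A`. -/
def Spans {G : Type*} [DecidableEq G] (r : Finset G → ℕ) (A : Finset G) (x : G) : Prop :=
  r (insert x A) = r A

section Rank

variable {G : Type*} [DecidableEq G]

theorem IsMRF.marginal_eq {v : Valuation G} (hv : IsMRF v) (S : Finset G) (g : G) :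
    marginal v S g = (rank v (insert g S) : ℝ) - (rank v S : ℝ) := by
  have h (S : Finset G) : (v S : ℝ) = (rank v S : ℝ) := by
    conv_lhs => rw [← hv.natFloor_eq S]
    simp [rank]
  rw [marginal, h, h]

theorem IsMRF.isRank {v : Valuation G} (hv : IsMRF v) : IsRank (rank v) := by
  have hb : ∀ S g, rank v (insert g S) = rank v S ∨ rank v (insert g S) = rank v S + 1 := by
    intro S g
    rcases hv.binary S g with h | h <;> rw [hv.marginal_eq] at h
    · left
      exact_mod_cast sub_eq_zero.mp h
    · right
      have := sub_eq_iff_eq_add'.mp h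
      exact_mod_cast this
  refine ⟨by simp [rank, hv.empty], fun S g => ?_, fun S g => ?_, fun S T g hST h => ?_⟩
  · rcases hb S g with h | h <;> omega
  · rcases hb S g with h | h <;> omega
  · have h1 := hv.submodular S T g hST
    rw [hv.marginal_eq, hv.marginal_eq, h, sub_self, sub_nonpos] at h1
    have h2 : rank v (insert g T) ≤ rank v T := by exact_mod_cast h1
    rcases hb T g with h | h <;> omega

variable {r : Finset G → ℕ}

theorem IsRank.mono (hr : IsRank r) {S T : Finset G} (h : S ⊆ T) : r S ≤ r T := by
  have key : ∀ U : Finset G, r S ≤ r (U ∪ S) := by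
    intro U
    induction U using Finset.induction_on with
    | empty => simp
    | insert g U _ ih =>
      rw [Finset.insert_union]
      exact ih.trans (hr.le_insert _ _)
  have := key T
  rwa [Finset.union_eq_left.mpr h] at this

theorem IsRank.union_le (hr : IsRank r) (S T : Finset G) : r (T ∪ S) ≤ r S + T.card := by
  induction T using Finset.induction_on with
  | empty => simp
  | insert g U hg ih =>
    rw [Finset.insert_union, Finset.card_insert_of_notMem hg]
    have := hr.insert_le (U ∪ S) g
    omega

theorem IsRank.le_card (hr : IsRank r) (S : Finset G) : r S ≤ S.card := by
  simpa [hr.empty] using hr.union_le ∅ S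

theorem IsRank.indep_subset (hr : IsRank r) {S T : Finset G} (h : S ⊆ T) (hT : r T = T.card) :
    r S = S.card := by
  have h1 := hr.union_le S (T \ S)
  rw [Finset.sdiff_union_of_subset h, Finset.card_sdiff_of_subset h] at h1
  have h2 := Finset.card_le_card h
  have h3 := hr.le_card S
  omega

theorem IsRank.spans_mono (hr : IsRank r) {A B : Finset G} {x : G} (h : A ⊆ B)
    (hx : Spans r A x) : Spans r B x :=
  hr.insert_eq A B x h hx

theorem IsRank.insert_of_not_spans (hr : IsRank r) {A : Finset G} {x : G} (hx : ¬ Spans r A x) :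
    r (insert x A) = r A + 1 := by
  have h1 := hr.le_insert A x
  have h2 := hr.insert_le A x
  unfold Spans at hx
  omega

theorem IsRank.union_eq_of_spans (hr : IsRank r) {A S : Finset G} (h : ∀ x ∈ S, Spans r A x) :
    r (S ∪ A) = r A := by
  induction S using Finset.induction_on with
  | empty => simp
  | insert g U hg ih =>
    rw [Finset.insert_union, ← ih fun x hx => h x (Finset.mem_insert_of_mem hx)]
    exact hr.spans_mono Finset.subset_union_right (h g (Finset.mem_insert_self _ _))

theorem IsRank.spans_iff_of_subset (hr : IsRank r) {A J : Finset G} (h : A ⊆ J) (hAJ : r A = r J)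
    (x : G) : Spans r A x ↔ Spans r J x := by
  refine ⟨hr.spans_mono h, fun hx => ?_⟩
  have h1 := hr.mono (Finset.insert_subset_insert x h)
  have h2 := hr.le_insert A x
  unfold Spans at *
  omega

/-- Exchanging `b` for `c` in an independent set does not change the span of what is left after the
deletion of `B`, provided `c` already lies in that span. -/
theorem IsRank.spans_exchange_iff (hr : IsRank r) {A I : Finset G} {b c : G}
    (hI : r (insert c (I.erase b)) = I.card) (hA : A ⊆ I) (hind : r I = I.card) (hb : b ∈ A)
    (hc : c ∉ I) (hspan : Spans r A c) (x : G) :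
    Spans r A x ↔ Spans r (insert c (A.erase b)) x := by
  have hcard : (insert c (I.erase b)).card = I.card := by
    rw [Finset.card_insert_of_notMem (fun h => hc (Finset.mem_of_mem_erase h)),
      Finset.card_erase_add_one (hA hb)]
  have h1 : r (insert c (A.erase b)) = A.card := by
    rw [hr.indep_subset (Finset.insert_subset_insert c (Finset.erase_subset_erase b hA))
      (hI.trans hcard.symm),
      Finset.card_insert_of_notMem (fun h => hc (hA (Finset.mem_of_mem_erase h))),
      Finset.card_erase_add_one hb]
  have h2 : r A = A.card := hr.indep_subset hA hind
  have h3 : r (insert c A) = r A := hspan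
  -- Both sets lie in `insert c A` and have its rank, so both have its span.
  rw [hr.spans_iff_of_subset (Finset.subset_insert c A) h3.symm,
    hr.spans_iff_of_subset (Finset.insert_subset_insert c (Finset.erase_subset b A))
      (h1.trans (h2.symm.trans h3.symm))]

/-- Otherwise matroid exchange puts `g` in the span of `A - g + x`, hence of `X - g + x`, which has
the same rank as `X - g`; this contradicts the independence of `X`. Iterated, it deletes from `X`
every good that is dispensable for spanning `x`. -/
theorem IsRank.spans_erase (hr : IsRank r) {X A : Finset G} {g x : G} (hX : r X = X.card)
    (hA : A ⊆ X) (hg : g ∈ X) (h1 : Spans r A x) (h2 : Spans r (X.erase g) x) :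
    Spans r (A.erase g) x := by
  by_cases hgA : g ∈ A
  swap
  · rwa [Finset.erase_eq_of_notMem hgA]
  by_contra hx
  have e1 := hr.insert_of_not_spans hx
  have e2 : r A = A.card := hr.indep_subset hA hX
  have e3 : r (A.erase g) = (A.erase g).card :=
    hr.indep_subset ((Finset.erase_subset _ _).trans hA) hX
  have e4 := Finset.card_erase_add_one hgA
  have e5 : Spans r (insert x (A.erase g)) g := by
    have : r (insert x A) = r A := h1
    rw [Spans, Finset.insert_comm, Finset.insert_erase hgA]
    omega
  have e6 : Spans r (insert x (X.erase g)) g :=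
    hr.spans_mono (Finset.insert_subset_insert x (Finset.erase_subset_erase g hA)) e5
  rw [Spans, Finset.insert_comm, Finset.insert_erase hg] at e6
  have e7 : r (X.erase g) = (X.erase g).card := hr.indep_subset (Finset.erase_subset _ _) hX
  have e8 := Finset.card_erase_add_one hg
  have e9 := hr.le_insert X x
  unfold Spans at h2
  omega

theorem IsRank.spans_sdiff (hr : IsRank r) {X B : Finset G} {x : G} (hX : r X = X.card)
    (hB : B ⊆ X) (h1 : Spans r X x) (h2 : ∀ g ∈ B, Spans r (X.erase g) x) :
    Spans r (X \ B) x := by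
  induction B using Finset.induction_on with
  | empty => simpa
  | insert g B _ ih =>
    rw [Finset.sdiff_insert]
    exact hr.spans_erase hX Finset.sdiff_subset (hB (Finset.mem_insert_self _ _))
      (ih ((Finset.subset_insert _ _).trans hB) fun y hy => h2 y (Finset.mem_insert_of_mem hy))
      (h2 g (Finset.mem_insert_self _ _))

theorem IsRank.exists_basis (hr : IsRank r) (S : Finset G) :
    ∃ T ⊆ S, r T = T.card ∧ r T = r S := by
  induction S using Finset.induction_on with
  | empty => exact ⟨∅, subset_rfl, by simp [hr.empty], rfl⟩
  | insert g S hg ih =>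
    obtain ⟨T, hTS, hT, hTr⟩ := ih
    by_cases h : Spans r T g
    · exact ⟨T, hTS.trans (Finset.subset_insert _ _), hT, by
        rw [hTr]; exact (hr.spans_mono hTS h).symm⟩
    · refine ⟨insert g T, Finset.insert_subset_insert g hTS, ?_, ?_⟩
      · rw [hr.insert_of_not_spans h, Finset.card_insert_of_notMem fun h => hg (hTS h), hT]
      · have := (hr.spans_iff_of_subset hTS hTr g).not.mp h
        rw [hr.insert_of_not_spans h, hr.insert_of_not_spans this, hTr]

end Rank

end YankeeSwap

namespace YankeeSwap

/-! ### Non-redundant allocations and augmentation along shortest paths -/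

section Augmentation

variable {G : Type*} [Fintype G] [DecidableEq G] {n : ℕ}

/-- Every agent has value `|X_i|` for its bundle `X_i`. -/
def NonRedundant (v : Fin n → Valuation G) (X : Allocation n G) : Prop :=
  ∀ j, rank (v j) (bundle X (some j)) = (bundle X (some j)).card

/-- The vector of the bundle sizes. -/
def cards (X : Allocation n G) (j : Fin n) : ℕ := (bundle X (some j)).card

omit [DecidableEq G] in
theorem mem_bundle {X : Allocation n G} {k : Option (Fin n)} {g : G} :
    g ∈ bundle X k ↔ X g = k := by
  simp [bundle]

omit [DecidableEq G] in
theorem NonRedundant.utilityVector_eq {v : Fin n → Valuation G} {X : Allocation n G}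
    (hX : NonRedundant v X) : utilityVector v X = cards X :=
  funext hX

variable {v : Fin n → Valuation G} {X : Allocation n G}

theorem mem_desired_iff (hv : ∀ j, IsMRF (v j)) {i : Fin n} {g : G} :
    g ∈ desired v X i ↔ ¬ Spans (rank (v i)) (bundle X (some i)) g := by
  have h1 := (hv i).isRank.le_insert (bundle X (some i)) g
  have h2 := (hv i).isRank.insert_le (bundle X (some i)) g
  rw [desired, Set.mem_ofPred_eq, (hv i).marginal_eq, sub_eq_iff_eq_add', Spans]
  norm_cast
  omega

/-- The bundle without `g` is independent and one short of the old value, so an edge means that `x`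
restores the missing unit. Edges thereby get the same form as membership in `desired`, with a
smaller set. -/
theorem exchangeEdge_iff (hv : ∀ j, IsMRF (v j)) (hX : NonRedundant v X) {k : Fin n} {g x : G}
    (hg : X g = some k) :
    ExchangeEdge v X g x ↔ ¬ Spans (rank (v k)) ((bundle X (some k)).erase g) x := by
  have hr := (hv k).isRank
  have hgX : g ∈ bundle X (some k) := mem_bundle.mpr hg
  have h1 := hr.le_insert ((bundle X (some k)).erase g) x
  have h2 := hr.insert_le ((bundle X (some k)).erase g) x
  have h3 := hr.indep_subset (Finset.erase_subset g _) (hX k)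
  have h4 := Finset.card_erase_add_one hgX
  have h5 := hX k
  rw [ExchangeEdge, hg, Spans]
  change v k _ = v k _ ↔ _
  rw [← (hv k).natFloor_eq (insert x _), ← (hv k).natFloor_eq (bundle X (some k)), Nat.cast_inj]
  change rank (v k) _ = rank (v k) _ ↔ _
  omega

/-- A list of goods along which goods can be passed on, with no shortcuts: the agent `k`, who
holds `A`, can add the first good and no other good of the list; the owner of each good can
replace it by the next one in the list and by no later one; and the last good is unallocated. -/
def Admissible (v : Fin n → Valuation G) (X : Allocation n G) :
    Fin n → Finset G → List G → Prop
  | _, _, [] => False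
  | k, A, g :: P => ¬ Spans (rank (v k)) A g ∧ (∀ s ∈ P, Spans (rank (v k)) A s) ∧
      ((X g = none ∧ P = []) ∨
        ∃ k', X g = some k' ∧ Admissible v X k' ((bundle X (some k')).erase g) P)

/-- The owner of `g'` passes `g'` to the pool and takes `g`. -/
def swapLast (X : Allocation n G) (g' g : G) : Allocation n G :=
  Function.update (Function.update X g (X g')) g' none

theorem bundle_swapLast_self {g g' : G} {k : Fin n} (hg : X g = none) (hg' : X g' = some k) :
    bundle (swapLast X g' g) (some k) = insert g ((bundle X (some k)).erase g') := by
  have hne : g ≠ g' := by rintro rfl; simp [hg] at hg'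
  ext x
  simp only [mem_bundle, swapLast, Function.update_apply, Finset.mem_insert, Finset.mem_erase, hg']
  split_ifs with h1 h2 <;> simp_all [eq_comm]

theorem bundle_swapLast_of_ne {g g' : G} {k j : Fin n} (hg : X g = none) (hg' : X g' = some k)
    (hj : j ≠ k) : bundle (swapLast X g' g) (some j) = bundle X (some j) := by
  ext x
  simp only [mem_bundle, swapLast, Function.update_apply, hg']
  split_ifs with h1 h2
  · subst h1; simp [hg', hj.symm]
  · subst h2; simp [hg, hj.symm]
  · rfl

theorem Admissible.spans_last {P : List G} {k : Fin n} {A : Finset G} {g' g : G}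
    (h : Admissible v X k A (P ++ [g', g])) : Spans (rank (v k)) A g := by
  cases P with
  | nil => exact h.2.1 g (by simp)
  | cons a P => exact h.2.1 g (by simp)

theorem Admissible.last_edge {P : List G} {k : Fin n} {A : Finset G} {g' g : G}
    (h : Admissible v X k A (P ++ [g', g])) :
    X g = none ∧ ∃ k', X g' = some k' ∧
      ¬ Spans (rank (v k')) ((bundle X (some k')).erase g') g := by
  induction P generalizing k A with
  | nil =>
    obtain ⟨-, -, h | ⟨k', hk', h1, -, h2⟩⟩ := h
    · simp at h
    · refine ⟨?_, k', hk', h1⟩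
      rcases h2 with h2 | ⟨_, _, h2⟩
      · exact h2.1
      · exact h2.elim
  | cons a P ih =>
    obtain ⟨-, -, h | ⟨k', hk', h⟩⟩ := h
    · simp at h
    · exact ih h

/-- If `B` avoids the two swapped goods and the rest of a bundle spans the good that comes in, then
the swap does not change the span of the rest of that bundle. -/
theorem spans_swapLast_iff (hv : ∀ j, IsMRF (v j)) (hX : NonRedundant v X) {g' g : G}
    {k j : Fin n} (hg : X g = none) (hg' : X g' = some k)
    (hns : ¬ Spans (rank (v k)) ((bundle X (some k)).erase g') g) {B : Finset G} (hB' : g' ∉ B)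
    (hB : g ∉ B) (hspan : Spans (rank (v j)) (bundle X (some j) \ B) g) (x : G) :
    Spans (rank (v j)) (bundle X (some j) \ B) x ↔
      Spans (rank (v j)) (bundle (swapLast X g' g) (some j) \ B) x := by
  by_cases hj : j = k
  swap
  · rw [bundle_swapLast_of_ne hg hg' hj]
  subst hj
  have hmem : g' ∈ bundle X (some j) := mem_bundle.mpr hg'
  rw [bundle_swapLast_self hg hg', Finset.insert_sdiff_of_notMem _ hB, Finset.erase_sdiff_comm]
  refine (hv j).isRank.spans_exchange_iff (I := bundle X (some j)) ?_ Finset.sdiff_subset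
    (hX j) (Finset.mem_sdiff.mpr ⟨hmem, hB'⟩) (by simp [mem_bundle, hg]) hspan x
  rw [(hv j).isRank.insert_of_not_spans hns,
    (hv j).isRank.indep_subset (Finset.erase_subset _ _) (hX j), Finset.card_erase_add_one hmem]

/-- Augmenting along a path amounts to first swapping along its last edge, and then augmenting
along the remaining path, which is still admissible. -/
theorem Admissible.swapLast (hv : ∀ j, IsMRF (v j)) (hX : NonRedundant v X) {g' g : G}
    {k' : Fin n} (hg : X g = none) (hg' : X g' = some k')
    (hns : ¬ Spans (rank (v k')) ((bundle X (some k')).erase g') g) {P : List G} {k : Fin n}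
    {A A' : Finset G} (hA : ∀ x, Spans (rank (v k)) A x ↔ Spans (rank (v k)) A' x)
    (h : Admissible v X k A (P ++ [g', g])) :
    Admissible v (swapLast X g' g) k A' (P ++ [g']) ∧
      augment X (some k) (P ++ [g', g]) = augment (swapLast X g' g) (some k) (P ++ [g']) := by
  have hne : g ≠ g' := by rintro rfl; simp [hg] at hg'
  induction P generalizing k A A' with
  | nil =>
    refine ⟨⟨fun h1 => h.1 ((hA _).mpr h1), by simp, Or.inl ⟨?_, rfl⟩⟩, ?_⟩
    · simp [YankeeSwap.swapLast]
    · simp [augment, YankeeSwap.swapLast]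
  | cons a P ih =>
    obtain ⟨h1, h2, h3 | ⟨k'', hk'', h3⟩⟩ := h
    · simp at h3
    have ha : a ≠ g := by rintro rfl; simp [hg] at hk''
    have ha' : a ≠ g' := by
      -- A path that used `g'` earlier would have a shortcut from there to `g`.
      rintro rfl
      obtain rfl : k' = k'' := by simpa [hg'] using hk''
      exact hns h3.spans_last
    have hXa : YankeeSwap.swapLast X g' g a = some k'' := by
      simp [YankeeSwap.swapLast, ha, ha', hk'']
    have h4 := h3.spans_last
    -- Since the path has no shortcuts, the bundle of `k''` without `a` spans `g`; hence the swap
    -- does not change that span, even when `k''` owns `g'`.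
    obtain ⟨h5, h6⟩ := ih (A' := (bundle (YankeeSwap.swapLast X g' g) (some k'')).erase a)
      (fun x => by
        rw [← Finset.sdiff_singleton_eq_erase] at h4 ⊢
        rw [← Finset.sdiff_singleton_eq_erase]
        exact spans_swapLast_iff hv hX hg hg' hns (by simpa using ha'.symm)
          (by simpa using ha.symm) h4 x) h3
    refine ⟨⟨fun h => h1 ((hA _).mpr h), fun s hs => (hA _).mp (h2 s ?_), Or.inr ⟨k'', hXa, h5⟩⟩,
      ?_⟩
    · refine List.mem_append.mpr ((List.mem_append.mp hs).imp_right fun h => ?_)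
      exact List.mem_cons.mpr (Or.inl (List.mem_singleton.mp h))
    · simp only [List.cons_append, augment]
      rw [hXa, hk'', h6]

theorem NonRedundant.swapLast (hv : ∀ j, IsMRF (v j)) (hX : NonRedundant v X) {g' g : G}
    {k' : Fin n} (hg : X g = none) (hg' : X g' = some k')
    (hns : ¬ Spans (rank (v k')) ((bundle X (some k')).erase g') g) :
    NonRedundant v (swapLast X g' g) ∧ cards (swapLast X g' g) = cards X := by
  have hmem : g' ∈ bundle X (some k') := mem_bundle.mpr hg'
  have hcard : (insert g ((bundle X (some k')).erase g')).card = (bundle X (some k')).card := by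
    rw [Finset.card_insert_of_notMem, Finset.card_erase_add_one hmem]
    simp [mem_bundle, hg]
  constructor
  · intro j
    by_cases hj : j = k'
    · subst hj
      rw [bundle_swapLast_self hg hg', hcard, (hv j).isRank.insert_of_not_spans hns,
        (hv j).isRank.indep_subset (Finset.erase_subset _ _) (hX j),
        Finset.card_erase_add_one hmem]
    · rw [bundle_swapLast_of_ne hg hg' hj, hX j]
  · ext j
    by_cases hj : j = k'
    · subst hj
      rw [cards, cards, bundle_swapLast_self hg hg', hcard]
    · rw [cards, cards, bundle_swapLast_of_ne hg hg' hj]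

/-- Augmentation along an admissible path adds one to the utility of its agent. -/
theorem NonRedundant.augment_of_admissible (hv : ∀ j, IsMRF (v j)) {i : Fin n} (P : List G) :
    ∀ {X : Allocation n G}, NonRedundant v X → Admissible v X i (bundle X (some i)) P →
      NonRedundant v (augment X (some i) P) ∧
        cards (augment X (some i) P) = addOne (cards X) i := by
  induction hlen : P.length generalizing P with
  | zero =>
    intro X _ h
    rw [List.length_eq_zero_iff.mp hlen] at h
    exact h.elim
  | succ m ih =>
    intro X hX h
    rcases P.eq_nil_or_concat with rfl | ⟨P, g, rfl⟩
    · exact h.elim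
    rcases P.eq_nil_or_concat with rfl | ⟨P, g', rfl⟩
    · obtain ⟨h1, -, h2⟩ := h
      have hg : X g = none := by
        rcases h2 with h2 | ⟨_, _, h2⟩
        · exact h2.1
        · exact h2.elim
      have hself : bundle (augment X (some i) [g]) (some i) = insert g (bundle X (some i)) := by
        ext x
        by_cases hx : x = g <;> simp [augment, mem_bundle, hx]
      have hother : ∀ j ≠ i, bundle (augment X (some i) [g]) (some j) = bundle X (some j) := by
        intro j hj
        ext x
        by_cases hx : x = g <;> simp [augment, mem_bundle, hx, hj.symm, hg]
      have hc : (insert g (bundle X (some i))).card = (bundle X (some i)).card + 1 :=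
        Finset.card_insert_of_notMem (by simp [mem_bundle, hg])
      change NonRedundant v (augment X (some i) [g]) ∧
        cards (augment X (some i) [g]) = addOne (cards X) i
      constructor
      · intro j
        by_cases hj : j = i
        · subst hj
          rw [hself, hc, (hv j).isRank.insert_of_not_spans h1, hX j]
        · rw [hother j hj, hX j]
      · ext j
        by_cases hj : j = i
        · subst hj
          simp [cards, addOne, hself, hc]
        · simp [cards, addOne, hother j hj, hj]
    · simp only [List.concat_eq_append, List.append_assoc, List.cons_append,
        List.nil_append] at h hlen ⊢
      -- Swapping along the last edge preserves all bundle sizes and leaves a shorter admissible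
      -- path, so the whole gain comes from the one-good base case.
      obtain ⟨hg, k', hg', hns⟩ := h.last_edge
      obtain ⟨h1, h2⟩ := h.swapLast hv hX hg hg' hns
        (A' := bundle (YankeeSwap.swapLast X g' g) (some i)) fun x => by
          simpa using spans_swapLast_iff hv hX hg hg' hns (B := ∅) (by simp) (by simp)
            (by simpa using h.spans_last) x
      obtain ⟨h3, h4⟩ := hX.swapLast hv hg hg' hns
      rw [h2, ← h4]
      exact ih _ (by simp at hlen ⊢; omega) h3 h1

/-! ### Shortest transfer paths are admissible -/

/-- `P` leads from the goods not spanned by the set `A` of agent `k` to the pool. -/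
def LeadsToPool (v : Fin n → Valuation G) (X : Allocation n G) (k : Fin n) (A : Finset G)
    (P : List G) : Prop :=
  ∃ hP : P ≠ [], ¬ Spans (rank (v k)) A (P.head hP) ∧ P.IsChain (ExchangeEdge v X) ∧
    X (P.getLast hP) = none

/-- A later good outside the span of `A` would start a shorter path, and an unallocated head would
be a path by itself. The tail is again shortest, now starting from the owner's bundle without the
head; the arbitrary set `A` is what lets the induction pass to it. -/
theorem Admissible.of_shortest (hv : ∀ j, IsMRF (v j)) (hX : NonRedundant v X) {P : List G} :
    ∀ {k : Fin n} {A : Finset G}, LeadsToPool v X k A P →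
      (∀ Q, LeadsToPool v X k A Q → P.length ≤ Q.length) → Admissible v X k A P := by
  induction P with
  | nil => exact fun h => (h.1 rfl).elim
  | cons g P ih =>
    rintro k A ⟨hP, hhead, hchain, hlast⟩ hshort
    refine ⟨hhead, fun s hs => ?_, ?_⟩
    · by_contra hns
      obtain ⟨P1, P2, rfl⟩ := List.append_of_mem hs
      have hsuf : (s :: P2) <:+ g :: (P1 ++ s :: P2) := ⟨g :: P1, by simp⟩
      have := hshort (s :: P2) ⟨by simp, hns, hchain.suffix hsuf, by simpa using hlast⟩
      simp at this; omega
    · cases P with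
      | nil => exact Or.inl ⟨by simpa using hlast, rfl⟩
      | cons g2 P =>
        right
        cases hXg : X g with
        | none =>
          have := hshort [g] ⟨by simp, hhead, by simp, by simpa using hXg⟩
          simp at this
        | some k' =>
          refine ⟨k', rfl, ih ⟨by simp, ?_, hchain.tail, by simpa using hlast⟩ fun Q hQ => ?_⟩
          · rw [List.head_cons, ← exchangeEdge_iff hv hX hXg]
            exact (List.isChain_cons_cons.mp hchain).1
          · obtain ⟨hQ0, hQhead, hQchain, hQlast⟩ := hQ
            have := hshort (g :: Q) ⟨by simp, hhead, ?_, by rwa [List.getLast_cons hQ0]⟩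
            · simpa using this
            · obtain ⟨q, Q, rfl⟩ := List.exists_cons_of_ne_nil hQ0
              exact List.isChain_cons_cons.mpr
                ⟨(exchangeEdge_iff hv hX hXg).mpr hQhead, hQchain⟩

theorem isTransferPath_iff (hv : ∀ j, IsMRF (v j)) {i : Fin n} {P : List G} :
    IsTransferPath v X i P ↔ LeadsToPool v X i (bundle X (some i)) P := by
  simp only [IsTransferPath, LeadsToPool, mem_desired_iff hv]

/-- Augmentation along a shortest transfer path keeps the allocation non-redundant and adds one to
the utility of the agent. -/
theorem NonRedundant.augment (hv : ∀ j, IsMRF (v j)) (hX : NonRedundant v X) {i : Fin n}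
    {P : List G} (hP : IsShortestTransferPath v X i P) :
    NonRedundant v (augment X (some i) P) ∧
      cards (YankeeSwap.augment X (some i) P) = addOne (cards X) i := by
  refine hX.augment_of_admissible hv P (.of_shortest hv hX ((isTransferPath_iff hv).mp hP.1) ?_)
  exact fun Q hQ => hP.2 Q ((isTransferPath_iff hv).mpr hQ)

end Augmentation

end YankeeSwap

namespace YankeeSwap

/-! ### The polymatroid of feasible utility vectors -/

section Feasible

variable {G : Type*} [Fintype G] [DecidableEq G] {n : ℕ}

theorem card_eq_sum_bundle_inter (X : Allocation n G) (D : Finset G) :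
    D.card = (bundle X none ∩ D).card + ∑ j, (bundle X (some j) ∩ D).card := by
  have h := Finset.card_eq_sum_card_fiberwise (f := X) (s := D) (t := Finset.univ)
    fun _ _ => Finset.mem_coe.mpr (Finset.mem_univ _)
  rw [h, Fintype.sum_option]
  have (k : Option (Fin n)) : D.filter (fun a => X a = k) = bundle X k ∩ D := by
    ext x
    simp [mem_bundle, and_comm]
  simp [this]

theorem sum_cards_le (X : Allocation n G) : ∑ j, cards X j ≤ Fintype.card G := by
  have := card_eq_sum_bundle_inter X Finset.univ
  simp only [Finset.inter_univ, Finset.card_univ] at this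
  simp only [cards]
  omega

variable {v : Fin n → Valuation G}

/-- Let `D` be the goods reachable from the desired goods of the deficient agents. Without a path,
`D` misses the pool. If `j` is deficient or owns a good of `D`, no edge leaves `D`, so `X_j \ D`
spans all goods outside `D` and is at least as large as `Y_j \ D`. Every other agent is not
deficient and has `X_j ∩ D` empty. Summing `key2` over the agents contradicts the strict inequality
of the sums. -/
theorem exists_isTransferPath (hv : ∀ j, IsMRF (v j)) {X Y : Allocation n G}
    (hX : NonRedundant v X) (hY : NonRedundant v Y) (hlt : ∑ j, cards X j < ∑ j, cards Y j) :
    ∃ j, cards X j < cards Y j ∧ ∃ P, IsTransferPath v X j P := by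
  classical
  by_contra! hno
  set D : Finset G := Finset.univ.filter fun x => ∃ j, cards X j < cards Y j ∧
    ∃ g ∈ desired v X j, Relation.ReflTransGen (ExchangeEdge v X) g x with hD
  have memD (x : G) : x ∈ D ↔ ∃ j, cards X j < cards Y j ∧
    ∃ g ∈ desired v X j, Relation.ReflTransGen (ExchangeEdge v X) g x := by simp [hD]
  have hpool : bundle X none ∩ D = ∅ := by
    refine Finset.eq_empty_of_forall_notMem fun x hx => ?_
    obtain ⟨hx, hxD⟩ := Finset.mem_inter.mp hx
    obtain ⟨j, hj, g, hg, hgx⟩ := (memD x).mp hxD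
    obtain ⟨l, hl, hlast⟩ := List.exists_isChain_cons_of_relationReflTransGen hgx
    exact hno j hj (g :: l) ⟨by simp, hg, hl, by rw [hlast]; exact mem_bundle.mp hx⟩
  have key (j : Fin n) (hj : cards X j < cards Y j ∨ ∃ g ∈ D, X g = some j) :
      (bundle Y (some j) \ D).card ≤ (bundle X (some j) \ D).card := by
    have hr := (hv j).isRank
    have hedge : ∀ x ∉ D, ∀ g ∈ D, X g = some j →
        Spans (rank (v j)) ((bundle X (some j)).erase g) x := by
      intro x hx g hg hgj
      by_contra hns
      obtain ⟨i, hi, g', hg', hpath⟩ := (memD g).mp hg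
      exact hx ((memD x).mpr ⟨i, hi, g', hg', hpath.tail ((exchangeEdge_iff hv hX hgj).mpr hns)⟩)
    have hspan : ∀ x ∉ D, Spans (rank (v j)) (bundle X (some j)) x := by
      intro x hx
      rcases hj with hj | ⟨g, hg, hgj⟩
      · by_contra hns
        exact hx ((memD x).mpr ⟨j, hj, x, (mem_desired_iff hv).mpr hns, .refl⟩)
      · exact hr.spans_mono (Finset.erase_subset _ _) (hedge x hx g hg hgj)
    have hspan' : ∀ x ∈ bundle Y (some j) \ D,
        Spans (rank (v j)) (bundle X (some j) \ D) x := by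
      intro x hx
      have hx := (Finset.mem_sdiff.mp hx).2
      rw [← Finset.sdiff_inter_self_left]
      refine hr.spans_sdiff (hX j) Finset.inter_subset_left (hspan x hx) fun g hg => ?_
      obtain ⟨hg1, hg2⟩ := Finset.mem_inter.mp hg
      exact hedge x hx g hg2 (mem_bundle.mp hg1)
    rw [← hr.indep_subset Finset.sdiff_subset (hX j), ← hr.indep_subset Finset.sdiff_subset (hY j),
      ← hr.union_eq_of_spans hspan']
    exact hr.mono Finset.subset_union_left
  have key2 (j : Fin n) : (bundle X (some j) ∩ D).card + cards Y j ≤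
      (bundle Y (some j) ∩ D).card + cards X j := by
    have h1 := Finset.card_inter_add_card_sdiff (bundle X (some j)) D
    have h2 := Finset.card_inter_add_card_sdiff (bundle Y (some j)) D
    by_cases hj : cards X j < cards Y j ∨ ∃ g ∈ D, X g = some j
    · have := key j hj
      unfold cards
      omega
    · push Not at hj
      have : bundle X (some j) ∩ D = ∅ := by
        refine Finset.eq_empty_of_forall_notMem fun x hx => ?_
        obtain ⟨hx, hxD⟩ := Finset.mem_inter.mp hx
        exact hj.2 x hxD (mem_bundle.mp hx)
      rw [this, Finset.card_empty]
      omega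
  have h1 := card_eq_sum_bundle_inter X D
  have h2 := card_eq_sum_bundle_inter Y D
  have h3 := Finset.sum_le_sum fun j (_ : j ∈ Finset.univ) => key2 j
  rw [Finset.sum_add_distrib, Finset.sum_add_distrib] at h3
  rw [hpool, Finset.card_empty] at h1
  omega

theorem exists_isShortestTransferPath {X : Allocation n G} {i : Fin n}
    (h : ∃ P, IsTransferPath v X i P) : ∃ P, IsShortestTransferPath v X i P := by
  obtain ⟨P, hP, hmin⟩ := WellFounded.has_min (measure (List.length (α := G))).wf
    {P | IsTransferPath v X i P} h
  exact ⟨P, hP, fun Q hQ => not_lt.mp (hmin Q hQ)⟩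

/-! ### Feasible vectors and the exchange property -/

/-- `z` is the utility vector of some non-redundant allocation. -/
def Feasible (v : Fin n → Valuation G) (z : Fin n → ℕ) : Prop :=
  ∃ X : Allocation n G, NonRedundant v X ∧ cards X = z

theorem sum_addOne (z : Fin n → ℕ) (i : Fin n) : ∑ j, addOne z i j = ∑ j, z j + 1 := by
  rw [addOne, Finset.sum_update_of_mem (Finset.mem_univ i),
    ← Finset.add_sum_erase _ _ (Finset.mem_univ i), Finset.sdiff_singleton_eq_erase]
  omega

/-- An allocation realizing the raised vector would give a path to some deficient agent, and only
`i` is deficient. -/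
theorem NonRedundant.not_feasible_addOne (hv : ∀ j, IsMRF (v j)) {X : Allocation n G}
    (hX : NonRedundant v X) {i : Fin n} (h : ¬ ∃ P, IsTransferPath v X i P) :
    ¬ Feasible v (addOne (cards X) i) := by
  rintro ⟨Y, hY, hYc⟩
  obtain ⟨j, hj, hP⟩ := exists_isTransferPath hv hX hY (by rw [hYc, sum_addOne]; omega)
  by_cases hji : j = i
  · exact h (hji ▸ hP)
  · simp [hYc, addOne, hji] at hj

/-- The exchange property of the polymatroid of feasible utility vectors. -/
theorem Feasible.exchange (hv : ∀ j, IsMRF (v j)) {x y : Fin n → ℕ} (hx : Feasible v x)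
    (hy : Feasible v y) (h : ∑ j, x j < ∑ j, y j) : ∃ j, x j < y j ∧ Feasible v (addOne x j) := by
  obtain ⟨X, hX, rfl⟩ := hx
  obtain ⟨Y, hY, rfl⟩ := hy
  obtain ⟨j, hj, hP⟩ := exists_isTransferPath hv hX hY h
  obtain ⟨P, hP⟩ := exists_isShortestTransferPath hP
  exact ⟨j, hj, _, hX.augment hv hP⟩

/-- Independent subsets of the bundles of an allocation form a non-redundant allocation. -/
theorem feasible_of_subset_bundle (X : Allocation n G) {S : Fin n → Finset G}
    (hS : ∀ j, S j ⊆ bundle X (some j)) (hind : ∀ j, rank (v j) (S j) = (S j).card) :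
    Feasible v fun j => (S j).card := by
  classical
  let Y : Allocation n G := fun g => (X g).bind fun j => if g ∈ S j then some j else none
  have hY (j : Fin n) : bundle Y (some j) = S j := by
    ext g
    rw [mem_bundle]
    cases hg : X g with
    | none =>
      have : g ∉ S j := fun h => by simpa [hg] using mem_bundle.mp (hS j h)
      simp [Y, hg, this]
    | some k =>
      by_cases hk : k = j
      · subst hk
        simp [Y, hg]
      · have : g ∉ S j := fun h => hk (by simpa [hg] using mem_bundle.mp (hS j h))
        simp [Y, hg, hk, this]
  exact ⟨Y, fun j => by rw [hY, hind], funext fun j => by rw [cards, hY]⟩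

theorem Feasible.mono (hv : ∀ j, IsMRF (v j)) {x y : Fin n → ℕ} (hy : Feasible v y)
    (h : ∀ j, x j ≤ y j) : Feasible v x := by
  obtain ⟨Y, hY, rfl⟩ := hy
  choose S hS hSx using fun j => Finset.exists_subset_card_eq (h j)
  have := feasible_of_subset_bundle (v := v) Y hS fun j => (hv j).isRank.indep_subset (hS j) (hY j)
  simpa [hSx] using this

/-- Feasibility of vectors that give nothing to `i` does not depend on the valuation of `i`. -/
theorem Feasible.congr_of_eq_zero {w : Fin n → Valuation G} (hw : ∀ j, IsMRF (w j)) {i : Fin n}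
    (hvw : ∀ j ≠ i, v j = w j) {x : Fin n → ℕ} (hx : Feasible v x) (hi : x i = 0) :
    Feasible w x := by
  obtain ⟨X, hX, rfl⟩ := hx
  refine ⟨X, fun j => ?_, rfl⟩
  by_cases hj : j = i
  · subst hj
    rw [Finset.card_eq_zero.mp hi]
    exact (hw j).isRank.empty
  · rw [← hvw j hj, hX j]

end Feasible

end YankeeSwap

namespace YankeeSwap

/-! ### Runs of General Yankee Swap -/

section Runs

variable {G : Type*} [Fintype G] [DecidableEq G] {n b : ℕ}

omit [Fintype G] in
theorem isMRF_zero : IsMRF (0 : Valuation G) :=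
  ⟨rfl, fun S g => Or.inl (by simp [marginal]), fun S T g _ => by simp [marginal]⟩

theorem isMRF_screen (r : Fin n → Valuation G) (j : Fin n) : IsMRF (screen r j) := by
  unfold screen
  split_ifs with h
  · exact h
  · exact isMRF_zero

theorem exists_isPicked (φ : GainFunction n b) (u : Fin n → ℕ) {U : Finset (Fin n)}
    (hU : U.Nonempty) : ∃ i, IsPicked φ u U i := by
  classical
  obtain ⟨m, hm, hmax⟩ := U.exists_max_image (φ u) hU
  obtain ⟨i, hi, hmin⟩ := (U.filter fun j => φ u j = φ u m).exists_min_image id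
    ⟨m, Finset.mem_filter.mpr ⟨hm, rfl⟩⟩
  obtain ⟨hiU, him⟩ := Finset.mem_filter.mp hi
  exact ⟨i, hiU, fun j hj => him ▸ hmax j hj,
    fun j hj hji => hmin j (Finset.mem_filter.mpr ⟨hj, hji.trans him⟩)⟩

theorem exists_run (φ : GainFunction n b) {v : Fin n → Valuation G} (hv : ∀ j, IsMRF (v j))
    (X : Allocation n G) (hX : NonRedundant v X) (U : Finset (Fin n)) :
    ∃ Y, Relation.ReflTransGen (Step φ v) (X, U) (Y, ∅) := by
  -- A transfer raises the sum of the bundle sizes, which never exceeds the number of goods; a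
  -- removal shrinks `U`.
  induction hm : Fintype.card G - ∑ j, cards X j + U.card using Nat.strong_induction_on
    generalizing X U with
  | _ m ih =>
  subst hm
  rcases U.eq_empty_or_nonempty with rfl | hU
  · exact ⟨X, .refl⟩
  obtain ⟨i, hi⟩ := exists_isPicked φ (utilityVector v X) hU
  by_cases hP : ∃ P, IsTransferPath v X i P
  · obtain ⟨P, hP⟩ := exists_isShortestTransferPath hP
    obtain ⟨h1, h2⟩ := hX.augment hv hP
    have h3 := sum_cards_le (augment X (some i) P)
    have h4 := sum_addOne (cards X) i
    rw [← h2] at h4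
    obtain ⟨Y, hY⟩ := ih _ (by omega) _ h1 U rfl
    exact ⟨Y, .head (.transfer X U i P hi hP) hY⟩
  · have h1 := Finset.card_erase_add_one hi.1
    obtain ⟨Y, hY⟩ := ih _ (by omega) X hX (U.erase i) rfl
    exact ⟨Y, .head (.remove X U i hi hP) hY⟩

theorem nonRedundant_none {v : Fin n → Valuation G} (hv : ∀ j, IsMRF (v j)) :
    NonRedundant v (fun _ => none : Allocation n G) := by
  intro j
  have : bundle (fun _ => none : Allocation n G) (some j) = ∅ := by ext; simp [mem_bundle]
  rw [this]
  exact (hv j).isRank.empty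

theorem mechanism_nonempty (φ : GainFunction n b) (r : Fin n → Valuation G) :
    (mechanism φ r).Nonempty :=
  exists_run φ (isMRF_screen r) _ (nonRedundant_none (isMRF_screen r)) _

/-! ### The priority order and the invariants of a run -/

/-- The `k`-th unit of agent `i` is considered before the `l`-th unit of agent `h`. -/
def Before (φ : GainFunction n b) (i : Fin n) (k : ℕ) (h : Fin n) (l : ℕ) : Prop :=
  φ (fun _ => l) h < φ (fun _ => k) i ∨ (φ (fun _ => l) h = φ (fun _ => k) i ∧ i < h)

theorem Before.asymm {φ : GainFunction n b} {i h : Fin n} {k l : ℕ} (h1 : Before φ i k h l) :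
    ¬ Before φ h l i k := by
  rintro (h2 | ⟨h2, h3⟩) <;> rcases h1 with h1 | ⟨h1, h4⟩
  · exact lt_asymm h1 h2
  · exact h2.ne' h1
  · exact h1.ne' h2
  · exact lt_asymm h3 h4

/-- A gain of an agent depends on its own utility alone, and antitonically so. -/
def OwnAntitone (φ : GainFunction n b) : Prop :=
  ∀ (x y : Fin n → ℕ) (i : Fin n), x i ≤ y i → φ y i ≤ φ x i ∧ (x i = y i → φ x i = φ y i)

/-- This justifies the constant vectors in `Before`: priorities can be compared across different
runs. -/
theorem OwnAntitone.eq_const {φ : GainFunction n b} (hφ : OwnAntitone φ) (x : Fin n → ℕ)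
    (i : Fin n) : φ x i = φ (fun _ => x i) i :=
  (hφ x (fun _ => x i) i le_rfl).2 rfl

theorem Before.mono_right {φ : GainFunction n b} (hφ : OwnAntitone φ) {i h : Fin n} {k l m : ℕ}
    (h1 : Before φ i k h l) (hlm : l ≤ m) : Before φ i k h m := by
  have h2 := (hφ (fun _ => l) (fun _ => m) h hlm).1
  rcases h1 with h1 | ⟨h1, h3⟩
  · exact Or.inl (h2.trans_lt h1)
  · rw [h1] at h2
    rcases h2.lt_or_eq with h2 | h2
    · exact Or.inl h2
    · exact Or.inr ⟨h2, h3⟩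

theorem IsPicked.before {φ : GainFunction n b} (hφ : OwnAntitone φ) {u : Fin n → ℕ}
    {U : Finset (Fin n)} {i j : Fin n} (hi : IsPicked φ u U i) (hj : j ∈ U) (hne : j ≠ i) :
    Before φ i (u i) j (u j) := by
  rw [Before, ← hφ.eq_const, ← hφ.eq_const]
  rcases (hi.2.1 j hj).lt_or_eq with h | h
  · exact Or.inl h
  · exact Or.inr ⟨h, lt_of_le_of_ne (hi.2.2 j hj h) hne.symm⟩

/-- `y` is the utility vector at a moment of a run at which agent `i` is picked. -/
structure Checkpoint (φ : GainFunction n b) (v : Fin n → Valuation G) (y : Fin n → ℕ)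
    (i : Fin n) : Prop where
  feasible : Feasible v y
  pending : ∀ h ≠ i, Feasible v (addOne y h) → Before φ i (y i) h (y h)
  accepted : ∀ h ≠ i, ∀ l < y h, Before φ h l i (y i)

/-- What is true at every moment of a run of General Yankee Swap. -/
structure RunInvariant (φ : GainFunction n b) (v : Fin n → Valuation G)
    (s : Allocation n G × Finset (Fin n)) : Prop where
  nonRedundant : NonRedundant v s.1
  removed : ∀ j ∉ s.2, ∃ y, Checkpoint φ v y j ∧ y j = cards s.1 j ∧ ¬ Feasible v (addOne y j)
  granted : ∀ j, ∀ k < cards s.1 j,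
    ∃ y, Checkpoint φ v y j ∧ y j = k ∧ ∀ h, addOne y j h ≤ cards s.1 h
  -- Removal is never regretted: utilities only grow, and feasibility is downward closed.
  stuck : ∀ j ∉ s.2, ¬ Feasible v (addOne (cards s.1) j)
  order : ∀ j ∈ s.2, ∀ h ≠ j, ∀ l < cards s.1 h, Before φ h l j (cards s.1 j)

variable {φ : GainFunction n b} {v : Fin n → Valuation G}

/-- An agent that could still gain is not stuck, hence is in play and loses to the picked agent. -/
theorem RunInvariant.checkpoint (hφ : OwnAntitone φ) {X : Allocation n G} {U : Finset (Fin n)}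
    (hs : RunInvariant φ v (X, U)) {i : Fin n} (hi : IsPicked φ (utilityVector v X) U i) :
    Checkpoint φ v (cards X) i where
  feasible := ⟨X, hs.nonRedundant, rfl⟩
  pending h hne hf := by
    rw [hs.nonRedundant.utilityVector_eq] at hi
    exact hi.before hφ (by_contra fun hU => hs.stuck h hU hf) hne
  accepted := hs.order i hi.1

theorem le_addOne (z : Fin n → ℕ) (i j : Fin n) : z j ≤ addOne z i j := by
  by_cases h : j = i
  · subst h; simp [addOne]
  · simp [addOne, h]

theorem addOne_mono {x y : Fin n → ℕ} (h : ∀ j, x j ≤ y j) (i j : Fin n) :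
    addOne x i j ≤ addOne y i j := by
  by_cases hj : j = i
  · subst hj; simp [addOne, h]
  · simp [addOne, hj, h]

theorem RunInvariant.step (hv : ∀ j, IsMRF (v j)) (hφ : OwnAntitone φ)
    {s t : Allocation n G × Finset (Fin n)} (hs : RunInvariant φ v s) (hst : Step φ v s t) :
    RunInvariant φ v t := by
  cases hst with
  | transfer X U i P hi hP =>
    obtain ⟨h1, h2⟩ := hs.nonRedundant.augment hv hP
    have hcp := hs.checkpoint hφ hi
    rw [hs.nonRedundant.utilityVector_eq] at hi
    have hself : addOne (cards X) i i = cards X i + 1 := by simp [addOne]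
    have hother : ∀ j ≠ i, addOne (cards X) i j = cards X j := fun j hj => by simp [addOne, hj]
    refine ⟨h1, fun j hj => ?_, fun j k hk => ?_, fun j hj hf => ?_, fun j hj h hne l hl => ?_⟩
    · have hji : j ≠ i := fun h => hj (h ▸ hi.1)
      simpa only [h2, hother j hji] using hs.removed j hj
    · simp only [h2] at hk ⊢
      by_cases hold : k < cards X j
      · obtain ⟨y, hy, hyk, hle⟩ := hs.granted j k hold
        exact ⟨y, hy, hyk, fun h => (hle h).trans (le_addOne _ _ _)⟩
      · have hji : j = i := by
          by_contra hji
          exact hold (hother j hji ▸ hk)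
        subst hji
        rw [hself] at hk
        exact ⟨cards X, hcp, by omega, fun h => le_rfl⟩
    · simp only [h2] at hf
      exact hs.stuck j hj (hf.mono hv (addOne_mono (le_addOne _ _) j))
    · simp only [h2] at hl ⊢
      by_cases hold : l < cards X h
      -- An old unit of `h`: if `j` is the agent just served, its next request has moved to a later
      -- unit.
      · exact (hs.order j hj h hne l hold).mono_right hφ (le_addOne _ _ _)
      · have hhi : h = i := by
          by_contra hhi
          exact hold (hother h hhi ▸ hl)
        subst hhi
        rw [hself] at hl
        obtain rfl : l = cards X h := by omega
        rw [hother j hne.symm]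
        exact hi.before hφ hj hne.symm
  | remove X U i hi hP =>
    have hcp := hs.checkpoint hφ hi
    have hnf := hs.nonRedundant.not_feasible_addOne hv hP
    refine ⟨hs.nonRedundant, fun j hj => ?_, hs.granted, fun j hj => ?_,
      fun j hj => hs.order j (Finset.mem_of_mem_erase hj)⟩
    · by_cases hji : j = i
      · subst hji
        exact ⟨_, hcp, rfl, hnf⟩
      · exact hs.removed j fun h => hj (Finset.mem_erase.mpr ⟨hji, h⟩)
    · by_cases hji : j = i
      · subst hji
        exact hnf
      · exact hs.stuck j fun h => hj (Finset.mem_erase.mpr ⟨hji, h⟩)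

theorem IsOutput.runInvariant (hv : ∀ j, IsMRF (v j)) (hφ : OwnAntitone φ) {X : Allocation n G}
    (hX : IsOutput φ v X) : RunInvariant φ v (X, ∅) := by
  have hc (j : Fin n) : cards (fun _ => none : Allocation n G) j = 0 := by
    rw [cards, Finset.card_eq_zero]
    ext
    simp [mem_bundle]
  unfold IsOutput at hX
  generalize (X, (∅ : Finset (Fin n))) = s at hX ⊢
  induction hX with
  | refl =>
    refine ⟨nonRedundant_none hv, ?_, ?_, ?_, ?_⟩ <;> simp [hc]
  | tail _ hst ih => exact ih.step hv hφ hst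

/-! ### Strategyproofness -/

theorem sum_update_zero (y : Fin n → ℕ) (i : Fin n) :
    ∑ j, Function.update y i 0 j + y i = ∑ j, y j := by
  rw [Finset.sum_update_of_mem (Finset.mem_univ i), ← Finset.add_sum_erase _ y (Finset.mem_univ i),
    Finset.sdiff_singleton_eq_erase]
  omega

/-- Restore the coordinate `i` one unit at a time by exchange against `addOne y i`. Off `i`, the
vector `addOne y j` is nowhere below `addOne y i`, so each exchange must raise `i`. -/
theorem feasible_addOne_of_update_zero (hv : ∀ j, IsMRF (v j)) {y : Fin n → ℕ} {i j : Fin n}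
    (hij : j ≠ i) (h1 : Feasible v (addOne (Function.update y i 0) j))
    (h2 : Feasible v (addOne y i)) : Feasible v (addOne y j) := by
  have hyi : addOne y j i = y i := by simp [addOne, hij.symm]
  have key : ∀ m ≤ y i, Feasible v (Function.update (addOne y j) i m) := by
    intro m
    induction m with
    | zero =>
      intro _
      rwa [addOne, Function.update_of_ne hij, Function.update_comm hij.symm] at h1
    | succ m ih =>
      intro hm
      have hlt : ∑ h, Function.update (addOne y j) i m h < ∑ h, addOne y i h := by
        have e1 := sum_addOne y i
        have e2 := sum_addOne y j
        have e3 := sum_update_zero (Function.update (addOne y j) i m) i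
        have e4 := sum_update_zero (addOne y j) i
        rw [Function.update_idem, Function.update_self] at e3
        omega
      obtain ⟨h, hh, hf⟩ := (ih (by omega)).exchange hv h2 hlt
      by_cases hhi : h = i
      · subst hhi
        simpa [addOne] using hf
      · have := le_addOne y j h
        simp [addOne, hhi] at hh this
        omega
  have := key (y i) le_rfl
  rwa [← hyi, Function.update_eq_self] at this

/-- If two profiles differ in the valuation of `i` only, then in the run on `w` agent `i` is not
removed with `k` goods if the run on `w'` grants it one more good than `k` in a way that is
feasible for `w`. -/
theorem Checkpoint.feasible_addOne {w w' : Fin n → Valuation G} (hw : ∀ j, IsMRF (w j))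
    (hw' : ∀ j, IsMRF (w' j)) {i : Fin n} (hww' : ∀ j ≠ i, w j = w' j) {y y' : Fin n → ℕ}
    (hy : Checkpoint φ w y i) (hy' : Checkpoint φ w' y' i) (heq : y' i = y i)
    (h1 : Feasible w' (addOne y' i)) (h2 : Feasible w (addOne y' i)) :
    Feasible w (addOne y i) := by
  have hle (z : Fin n → ℕ) (j : Fin n) : Function.update z i 0 j ≤ z j := by
    by_cases hj : j = i
    · subst hj; simp
    · simp [hj]
  have hothers : ∑ j, Function.update y i 0 j ≤ ∑ j, Function.update y' i 0 j := by
    by_contra! hlt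
    -- With coordinate `i` set to zero, feasibility passes from one profile to the other.
    have hb : Feasible w' (Function.update y i 0) :=
      (hy.feasible.mono hw (hle y)).congr_of_eq_zero hw' hww' (by simp)
    obtain ⟨j, hj, hf⟩ := (hy'.feasible.mono hw' (hle y')).exchange hw' hb hlt
    have hji : j ≠ i := by rintro rfl; simp at hj
    rw [Function.update_of_ne hji, Function.update_of_ne hji] at hj
    have e1 := hy'.pending j hji (feasible_addOne_of_update_zero hw' hji hf h1)
    have e2 := hy.accepted j hji _ hj
    rw [← heq] at e2
    -- The run on `w'` still has this unit of `j` pending when it serves `i`, while the run on `w`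
    -- granted it before the same request of `i`.
    exact e1.asymm e2
  have hlt : ∑ j, y j < ∑ j, addOne y' i j := by
    have e1 := sum_update_zero y i
    have e2 := sum_update_zero y' i
    have e3 := sum_addOne y' i
    omega
  obtain ⟨j, hj, hf⟩ := hy.feasible.exchange hw h2 hlt
  by_cases hji : j = i
  · exact hji ▸ hf
  · simp only [addOne, Function.update_of_ne hji] at hj
    have e1 := hy.pending j hji hf
    have e2 := hy'.accepted j hji _ hj
    rw [heq] at e2
    exact (e1.asymm e2).elim

theorem mechanism_strategyproofOn (hφ : OwnAntitone φ) :
    StrategyproofOn {v : Valuation G | IsMRF v} (mechanism φ) := by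
  intro r i v hv X hX X' hX'
  have hv : IsMRF v := hv
  have hw := isMRF_screen (Function.update r i v)
  have hw' := isMRF_screen r
  have hww' : ∀ j ≠ i, screen (Function.update r i v) j = screen r j := fun j hj => by
    rw [screen, screen, Function.update_of_ne hj]
  have hwi : screen (Function.update r i v) i = v := by simp [screen, hv]
  have inv := IsOutput.runInvariant hw hφ hX
  have inv' := IsOutput.runInvariant hw' hφ hX'
  suffices hrank : rank v (bundle X' (some i)) ≤ rank v (bundle X (some i)) by
    rw [← hv.natFloor_eq (bundle X' (some i)), ← hv.natFloor_eq (bundle X (some i))]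
    exact_mod_cast hrank
  have hXi := inv.nonRedundant i
  rw [hwi] at hXi
  -- The bundle won by misreporting need not be independent for the true `v`; `T` keeps its true
  -- value without redundancy.
  obtain ⟨T, hT, hTind, hTr⟩ := hv.isRank.exists_basis (bundle X' (some i))
  by_contra! hlt
  rw [hXi, ← hTr, hTind] at hlt
  obtain ⟨y, hy, hyi, hnf⟩ := inv.removed i (Finset.notMem_empty i)
  obtain ⟨y', hy', hyi', hle⟩ := inv'.granted i (cards X i)
    (hlt.trans_le (Finset.card_le_card hT))
  have hgrant : Feasible (screen r) (addOne y' i) :=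
    Feasible.mono hw' ⟨X', inv'.nonRedundant, rfl⟩ hle
  refine hnf (hy.feasible_addOne hw hw' hww' hy' (hyi'.trans hyi.symm) hgrant ?_)
  -- Replacing the bundle of `i` by `T` gives a vector that is feasible for the truthful profile; it
  -- dominates `addOne y' i` because `T` has more than `cards X i` goods.
  have hS := feasible_of_subset_bundle (v := screen (Function.update r i v)) X'
    (S := Function.update (fun j => bundle X' (some j)) i T)
    (fun j => by
      by_cases hj : j = i
      · subst hj; simpa using hT
      · simp [hj])
    (fun j => by
      by_cases hj : j = i
      · subst hj; rw [hwi]; simpa using hTind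
      · simpa [hj, hww' j hj] using inv'.nonRedundant j)
  refine hS.mono hw fun j => ?_
  by_cases hj : j = i
  · subst hj
    simp only [addOne, Function.update_self, hyi']
    exact hlt
  · simpa [addOne, hj, cards] using hle j

end Runs

end YankeeSwap

theorem mainTheorem2 {G : Type*} [Fintype G] [DecidableEq G] {n b : ℕ}
    (φ : YankeeSwap.GainFunction n b) (hφ : YankeeSwap.IsValidGainFunction φ) :
    (∀ r : Fin n → YankeeSwap.Valuation G, (YankeeSwap.mechanism φ r).Nonempty) ∧
      YankeeSwap.StrategyproofOn {v : YankeeSwap.Valuation G | YankeeSwap.IsMRF v}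
        (YankeeSwap.mechanism φ) := by
  exact ⟨YankeeSwap.mechanism_nonempty φ, YankeeSwap.mechanism_strategyproofOn fun x y i h =>
    hφ.choose_spec.2.antitone x y i h⟩
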